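/- Let $(T,d)$ be a compact metric space, let $K=\mathbb{R}$ or $K=\mathbb{C}$, let $n\ge 1$ be an integer, and let $K^n$ carry the scalar product $(x\mid y)=\sum_{i=1}^n x_i\overline{y_i}$ and the corresponding norm. Let $\mathrm{cabv}(K^n)$ be the $K$-vector space of all $\sigma$-additive measures $\mu$ of bounded variation defined on the Borel sets of $T$ with values in $K^n$; put $\|\mu\|=|\mu|(T)$, where $|\mu|$ is the variation of $\mu$, and $B_a(K^n)=\{\mu\in \mathrm{cabv}(K^n):\|\mu\|\le a\}$ for $a>0$. For $\mu\in\mathrm{cabv}(K^n)$ and continuous $f:T\to K^n$, let $\int f\,d\mu\in K$ be the integral determined by $\int \varphi_A x\,d\mu=(x\mid\mu(A))$ (for Borel $A\subset T$ and $x\in K^n$, with $\varphi_A$ the indicator function of $A$), by linearity in $f$ and by uniform limits. The Monge-Kantorovich norm on $\mathrm{cabv}(K^n)$ is $$\|\mu\|_{MK}=\sup\Big\{\Big|\int f\,d\mu\Big| : f:T\to K^n \text{ Lipschitz},\ \sup_{t\in T}\|f(t)\|+\sup_{x\ne y}\frac{\|f(x)-f(y)\|}{d(x,y)}\le 1\Big\}$$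 (suprema over the empty set being $0$), and the weak* topology on $\mathrm{cabv}(K^n)$ is the locally convex topology generated by the seminorms $\mu\mapsto\left|\int f\,d\mu\right|$, where $f$ runs over all continuous functions $T\to K^n$. Then, for every $a>0$, the set $B_a(K^n)$, equipped with the metric $(\mu,\nu)\mapsto\|\mu-\nu\|_{MK}$, is a compact, hence complete, metric space, and its topology is exactly the topology induced on $B_a(K^n)$ by the weak* topology. If $T$ is infinite, the normed space $(\mathrm{cabv}(K^n),\|\cdot\|_{MK})$ is not complete. -/

import Mathlib

open MeasureTheory Filter Topology
open scoped ENNReal NNReal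

noncomputable section

namespace MongeKantorovich

/-- The Hilbert space `K^n` with its Euclidean norm. -/
abbrev Vec (𝕜 : Type*) (n : ℕ) := EuclideanSpace 𝕜 (Fin n)

section Pairing

variable (𝕜 : Type*) [RCLike 𝕜] (n : ℕ)

/-- The scalar product `(x | y) = ∑ i, x i * conj (y i)` on `K^n`, linear in `x` and antilinear
in `y`, as a continuous real-bilinear map. -/
def pairing : Vec 𝕜 n →L[ℝ] Vec 𝕜 n →L[ℝ] 𝕜 :=
  LinearMap.mkContinuous₂
    (LinearMap.mk₂ ℝ (fun x y : Vec 𝕜 n => (inner 𝕜 y x : 𝕜))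
      (fun x x' y => inner_add_right y x x')
      (fun c x y => by
        rw [RCLike.real_smul_eq_coe_smul (K := 𝕜) c x, inner_smul_right,
          RCLike.real_smul_eq_coe_mul])
      (fun x y y' => inner_add_left y y' x)
      (fun c x y => by
        rw [RCLike.real_smul_eq_coe_smul (K := 𝕜) c y, inner_smul_left, RCLike.conj_ofReal,
          RCLike.real_smul_eq_coe_mul]))
    1 (fun x y => by
      rw [LinearMap.mk₂_apply, one_mul, mul_comm]
      exact norm_inner_le_norm y x)

variable {𝕜 n}

theorem pairing_apply (x y : Vec 𝕜 n) : pairing 𝕜 n x y = inner 𝕜 y x := rfl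

theorem norm_pairing_le : ‖pairing 𝕜 n‖ ≤ 1 :=
  LinearMap.mkContinuous₂_norm_le _ zero_le_one _

end Pairing

variable (T : Type*) [MetricSpace T] [CompactSpace T] [MeasurableSpace T] [BorelSpace T]
  (𝕜 : Type*) [RCLike 𝕜] (n : ℕ)

/-- `cabv (K^n)`: the `𝕜`-vector space of the σ-additive Borel measures `μ` on `T` with values in
`K^n` that have bounded variation, `|μ|(T) < ∞`. -/
def Cabv : Submodule 𝕜 (VectorMeasure T (Vec 𝕜 n)) where
  carrier := {μ | μ.variation Set.univ < ∞}
  zero_mem' := by simp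
  add_mem' := fun {μ ν} hμ hν =>
    lt_of_le_of_lt (VectorMeasure.variation_add_le Set.univ) (by
      simpa using ENNReal.add_lt_top.2 ⟨hμ, hν⟩)
  smul_mem' := fun c μ hμ => by
    have h : (c • μ).variation Set.univ = ‖c‖₊ • μ.variation Set.univ := by
      rw [VectorMeasure.variation_smul]; rfl
    change (c • μ).variation Set.univ < ∞
    rw [h]
    exact ENNReal.mul_lt_top ENNReal.coe_lt_top hμ

variable {T 𝕜 n}

instance instIsFiniteMeasureVariation (μ : Cabv T 𝕜 n) : IsFiniteMeasure μ.1.variation := ⟨μ.2⟩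

/-- The variational norm `‖μ‖ = |μ|(T)`. -/
def varNorm (μ : Cabv T 𝕜 n) : ℝ := (μ.1.variation Set.univ).toReal

variable (T 𝕜 n) in
/-- `B_a(K^n)`: the measures whose variational norm is at most `a`. -/
def varBall (a : ℝ) : Set (Cabv T 𝕜 n) := {μ | varNorm μ ≤ a}

/-- The sesquilinear integral `∫ f dμ ∈ K` of a continuous function `f : T → K^n`: the integral
of `f` against the vector measure `μ` through the scalar product of `K^n`. -/
def sesqInt (f : C(T, Vec 𝕜 n)) (μ : Cabv T 𝕜 n) : 𝕜 :=
  μ.1.integral (⇑f) (pairing 𝕜 n)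

/-- `f` is a Lipschitz function. -/
def IsLip (f : C(T, Vec 𝕜 n)) : Prop := ∃ M : ℝ≥0, LipschitzWith M f

/-- The Lipschitz constant `‖f‖_L = sup {‖f x - f y‖ / d(x, y) | x ≠ y}`. -/
def lipConst (f : C(T, Vec 𝕜 n)) : ℝ :=
  sSup {r : ℝ | ∃ x y : T, x ≠ y ∧ r = ‖f x - f y‖ / dist x y}

variable (T 𝕜 n) in
/-- `BL_1(K^n)`: the Lipschitz functions `f` with `‖f‖_BL = ‖f‖ + ‖f‖_L ≤ 1`, where `‖f‖` is the
supremum norm. -/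
def unitBL : Set C(T, Vec 𝕜 n) := {f | IsLip f ∧ ‖f‖ + lipConst f ≤ 1}

/-- `‖μ‖_MK = sup {|∫ f dμ| | f ∈ BL_1(K^n)}`. -/
def mkNorm (μ : Cabv T 𝕜 n) : ℝ :=
  sSup {r : ℝ | ∃ f ∈ unitBL T 𝕜 n, r = ‖sesqInt f μ‖}

section Facts

set_option linter.unusedSectionVars false

theorem integrable_of_continuous (f : C(T, Vec 𝕜 n)) (μ : Cabv T 𝕜 n) :
    μ.1.Integrable f :=
  Integrable.of_bound f.continuous.aestronglyMeasurable ‖f‖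
    (Eventually.of_forall fun x => f.norm_coe_le_norm x)

theorem sesqInt_zero (f : C(T, Vec 𝕜 n)) : sesqInt f (0 : Cabv T 𝕜 n) = 0 :=
  VectorMeasure.integral_zero_vectorMeasure

theorem sesqInt_add (f : C(T, Vec 𝕜 n)) (μ ν : Cabv T 𝕜 n) :
    sesqInt f (μ + ν) = sesqInt f μ + sesqInt f ν :=
  VectorMeasure.integral_add_vectorMeasure (integrable_of_continuous f μ)
    (integrable_of_continuous f ν)

/-- On the simple function `φ_A x` the integral is `(x | μ A)`. -/
theorem integral_indicator_const (μ : Cabv T 𝕜 n) {A : Set T} (hA : MeasurableSet A)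
    (x : Vec 𝕜 n) :
    μ.1.integral (A.indicator fun _ => x) (pairing 𝕜 n) = inner 𝕜 (μ.1 A) x := by
  rw [VectorMeasure.integral_eq_setToFun]
  exact setToFun_indicator_const (dominatedFinMeasAdditive_cbmApplyMeasure _ _)
    hA (measure_ne_top _ _) x

open Classical in
theorem integral_simpleFunc_smul (c : 𝕜) (g : SimpleFunc T (Vec 𝕜 n)) (μ : Cabv T 𝕜 n) :
    (c • μ).1.integral g (pairing 𝕜 n) =
      (starRingEnd 𝕜) c * μ.1.integral g (pairing 𝕜 n) := by
  induction g using SimpleFunc.induction with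
  | @const x s hs =>
    have key : ∀ ν : Cabv T 𝕜 n, ν.1.integral
        ((SimpleFunc.piecewise s hs (SimpleFunc.const T x) (SimpleFunc.const T 0) :
          SimpleFunc T (Vec 𝕜 n))) (pairing 𝕜 n) = inner 𝕜 (ν.1 s) x := by
      intro ν
      rw [SimpleFunc.coe_piecewise, SimpleFunc.coe_const, SimpleFunc.coe_const,
        Function.const_zero, Set.piecewise_eq_indicator]
      exact integral_indicator_const ν hs x
    rw [key, key]
    exact inner_smul_left _ _ _
  | @add f g _ hf hg =>
    have hi : ∀ (ν : Cabv T 𝕜 n) (h : SimpleFunc T (Vec 𝕜 n)), ν.1.Integrable h := fun ν h =>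
      h.integrable_of_isFiniteMeasure
    rw [SimpleFunc.coe_add, VectorMeasure.integral_add (hi _ _) (hi _ _),
      VectorMeasure.integral_add (hi _ _) (hi _ _), hf, hg, mul_add]

theorem sesqInt_smul (f : C(T, Vec 𝕜 n)) (c : 𝕜) (μ : Cabv T 𝕜 n) :
    sesqInt f (c • μ) = (starRingEnd 𝕜) c * sesqInt f μ := by
  have hf : StronglyMeasurable f := f.continuous.stronglyMeasurable
  have lim : ∀ ν : Cabv T 𝕜 n,
      Tendsto (fun k => ν.1.integral (hf.approxBounded ‖f‖ k) (pairing 𝕜 n)) atTop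
        (𝓝 (sesqInt f ν)) := fun ν =>
    VectorMeasure.tendsto_integral_of_dominated_convergence (fun _ => ‖f‖)
      (fun k => (hf.approxBounded ‖f‖ k).stronglyMeasurable.aestronglyMeasurable)
      (integrable_const _)
      (fun k => Eventually.of_forall fun x => hf.norm_approxBounded_le (norm_nonneg _) k x)
      (Eventually.of_forall fun x =>
        hf.tendsto_approxBounded_of_norm_le (f.norm_coe_le_norm x))
  refine tendsto_nhds_unique (lim (c • μ)) ?_
  simp_rw [integral_simpleFunc_smul]
  exact (lim μ).const_mul _

theorem sesqInt_neg (f : C(T, Vec 𝕜 n)) (μ : Cabv T 𝕜 n) : sesqInt f (-μ) = -sesqInt f μ := by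
  rw [← neg_one_smul 𝕜 μ, sesqInt_smul]
  simp

theorem norm_sesqInt_le (f : C(T, Vec 𝕜 n)) (μ : Cabv T 𝕜 n) :
    ‖sesqInt f μ‖ ≤ ‖f‖ * varNorm μ := by
  refine (VectorMeasure.norm_integral_le_of_norm_le_const (C := ‖f‖)
    (Eventually.of_forall fun x => f.norm_coe_le_norm x)).trans ?_
  refine mul_le_mul_of_nonneg_right ?_ ENNReal.toReal_nonneg
  exact mul_le_of_le_one_right (norm_nonneg f) norm_pairing_le

theorem lipConst_nonneg (f : C(T, Vec 𝕜 n)) : 0 ≤ lipConst f := by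
  refine Real.sSup_nonneg ?_
  rintro r ⟨x, y, _, rfl⟩
  positivity

theorem lipConst_le {f : C(T, Vec 𝕜 n)} {M : ℝ≥0} (h : LipschitzWith M f) : lipConst f ≤ M := by
  refine Real.sSup_le ?_ M.2
  rintro r ⟨x, y, hxy, rfl⟩
  rw [div_le_iff₀ (dist_pos.2 hxy), ← dist_eq_norm]
  exact h.dist_le_mul x y

theorem lipschitzWith_smul_const (c : ℝ) {f : C(T, Vec 𝕜 n)} {M : ℝ≥0} (h : LipschitzWith M f) :
    LipschitzWith (‖c‖₊ * M) (c • f : C(T, Vec 𝕜 n)) := by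
  refine LipschitzWith.of_dist_le_mul fun x y => ?_
  rw [ContinuousMap.smul_apply, ContinuousMap.smul_apply, dist_smul₀, NNReal.coe_mul, mul_assoc]
  exact mul_le_mul_of_nonneg_left (h.dist_le_mul x y) (norm_nonneg c)

theorem bddAbove_mkNorm (μ : Cabv T 𝕜 n) :
    BddAbove {r : ℝ | ∃ f ∈ unitBL T 𝕜 n, r = ‖sesqInt f μ‖} := by
  refine ⟨varNorm μ, ?_⟩
  rintro r ⟨f, hf, rfl⟩
  refine (norm_sesqInt_le f μ).trans (mul_le_of_le_one_left ENNReal.toReal_nonneg ?_)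
  linarith [hf.2, lipConst_nonneg f]

theorem norm_sesqInt_le_mkNorm {f : C(T, Vec 𝕜 n)} (hf : f ∈ unitBL T 𝕜 n) (μ : Cabv T 𝕜 n) :
    ‖sesqInt f μ‖ ≤ mkNorm μ :=
  le_csSup (bddAbove_mkNorm μ) ⟨f, hf, rfl⟩

theorem mkNorm_nonneg (μ : Cabv T 𝕜 n) : 0 ≤ mkNorm μ := by
  refine Real.sSup_nonneg ?_
  rintro r ⟨f, _, rfl⟩
  positivity

theorem mkNorm_zero : mkNorm (0 : Cabv T 𝕜 n) = 0 := by
  refine le_antisymm (Real.sSup_le ?_ le_rfl) (mkNorm_nonneg _)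
  rintro r ⟨f, _, rfl⟩
  rw [sesqInt_zero, norm_zero]

theorem mkNorm_add_le (μ ν : Cabv T 𝕜 n) : mkNorm (μ + ν) ≤ mkNorm μ + mkNorm ν := by
  refine Real.sSup_le ?_ (add_nonneg (mkNorm_nonneg μ) (mkNorm_nonneg ν))
  rintro r ⟨f, hf, rfl⟩
  rw [sesqInt_add]
  exact (norm_add_le _ _).trans
    (add_le_add (norm_sesqInt_le_mkNorm hf μ) (norm_sesqInt_le_mkNorm hf ν))

theorem mkNorm_smul_le (c : 𝕜) (μ : Cabv T 𝕜 n) : mkNorm (c • μ) ≤ ‖c‖ * mkNorm μ := by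
  refine Real.sSup_le ?_ (mul_nonneg (norm_nonneg c) (mkNorm_nonneg μ))
  rintro r ⟨f, hf, rfl⟩
  rw [sesqInt_smul, norm_mul, RCLike.norm_conj]
  exact mul_le_mul_of_nonneg_left (norm_sesqInt_le_mkNorm hf μ) (norm_nonneg c)

/-- A measure of Monge-Kantorovich norm zero annihilates all Lipschitz functions. -/
theorem sesqInt_eq_zero_of_mkNorm {μ : Cabv T 𝕜 n} (h : mkNorm μ = 0)
    {f : C(T, Vec 𝕜 n)} {M : ℝ≥0} (hf : LipschitzWith M f) : sesqInt f μ = 0 := by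
  set R : ℝ := 1 + ‖f‖ + M with hR
  have hR0 : 0 < R := by positivity
  have hmem : (R⁻¹ • f : C(T, Vec 𝕜 n)) ∈ unitBL T 𝕜 n := by
    refine ⟨⟨_, lipschitzWith_smul_const R⁻¹ hf⟩, ?_⟩
    have h1 := lipConst_le (lipschitzWith_smul_const R⁻¹ hf)
    rw [NNReal.coe_mul, coe_nnnorm, Real.norm_of_nonneg (inv_nonneg.2 hR0.le)] at h1
    have h2 : ‖(R⁻¹ • f : C(T, Vec 𝕜 n))‖ = R⁻¹ * ‖f‖ := by
      rw [norm_smul, Real.norm_of_nonneg (inv_nonneg.2 hR0.le)]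
    have h3 : R⁻¹ * ‖f‖ + R⁻¹ * M ≤ 1 := by
      rw [← mul_add, inv_mul_le_iff₀ hR0]
      linarith
    linarith
  have h0 : sesqInt (R⁻¹ • f : C(T, Vec 𝕜 n)) μ = 0 :=
    norm_le_zero_iff.1 ((norm_sesqInt_le_mkNorm hmem μ).trans h.le)
  have h1 : sesqInt (R⁻¹ • f : C(T, Vec 𝕜 n)) μ = R⁻¹ • sesqInt f μ :=
    VectorMeasure.integral_smul (μ := μ.1) (f := ⇑f) (B := pairing 𝕜 n) R⁻¹
  rw [h1] at h0
  exact (smul_eq_zero.1 h0).resolve_left (inv_ne_zero hR0.ne')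

theorem eq_zero_of_mkNorm {μ : Cabv T 𝕜 n} (h : mkNorm μ = 0) : μ = 0 := by
  have closed : ∀ F : Set T, IsClosed F → μ.1 F = 0 := by
    intro F hF
    have hpair : ∀ v : Vec 𝕜 n, pairing 𝕜 n v (μ.1 F) = 0 := by
      intro v
      have hδ : ∀ k : ℕ, (0 : ℝ) < 1 / ((k : ℝ) + 1) := fun k => by positivity
      let φ : ℕ → C(T, Vec 𝕜 n) := fun k =>
        ⟨fun x => ((thickenedIndicator (hδ k) F x : ℝ≥0) : ℝ) • v, by fun_prop⟩
      have hφ : ∀ k, sesqInt (φ k) μ = 0 := by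
        intro k
        have hL := lipschitzWith_thickenedIndicator (hδ k) F
        refine sesqInt_eq_zero_of_mkNorm h
          (M := (1 / ((k : ℝ) + 1)).toNNReal⁻¹ * ‖v‖₊) ?_
        refine LipschitzWith.of_dist_le_mul fun x y => ?_
        change dist (((thickenedIndicator (hδ k) F x : ℝ≥0) : ℝ) • v)
          (((thickenedIndicator (hδ k) F y : ℝ≥0) : ℝ) • v) ≤ _
        rw [dist_eq_norm, ← sub_smul, norm_smul, NNReal.coe_mul, coe_nnnorm, mul_right_comm]
        exact mul_le_mul_of_nonneg_right (hL.dist_le_mul x y) (norm_nonneg v)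
      have hlim : Tendsto (fun k => sesqInt (φ k) μ) atTop
          (𝓝 (μ.1.integral (F.indicator fun _ => v) (pairing 𝕜 n))) := by
        refine VectorMeasure.tendsto_integral_of_dominated_convergence (fun _ => ‖v‖)
          (fun k => (φ k).continuous.aestronglyMeasurable) (integrable_const _)
          (fun k => Eventually.of_forall fun x => ?_) (Eventually.of_forall fun x => ?_)
        · change ‖((thickenedIndicator (hδ k) F x : ℝ≥0) : ℝ) • v‖ ≤ ‖v‖
          rw [norm_smul, Real.norm_of_nonneg (NNReal.coe_nonneg _)]
          exact mul_le_of_le_one_left (norm_nonneg v)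
            (by exact_mod_cast thickenedIndicator_le_one (hδ k) F x)
        · have h1 := (tendsto_pi_nhds.1 (thickenedIndicator_tendsto_indicator_closure hδ
            tendsto_one_div_add_atTop_nhds_zero_nat F)) x
          rw [hF.closure_eq] at h1
          have h2 := ((NNReal.tendsto_coe.2 h1).smul_const v)
          have h4 : ((F.indicator (fun _ => (1 : ℝ≥0)) x : ℝ≥0) : ℝ) • v =
              F.indicator (fun _ => v) x := by
            by_cases hx : x ∈ F <;> simp [hx]
          rw [← h4]
          exact h2
      simp_rw [hφ] at hlim
      have h3 := tendsto_nhds_unique tendsto_const_nhds hlim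
      rw [h3, integral_indicator_const μ hF.measurableSet, pairing_apply]
    exact inner_self_eq_zero.1 (hpair (μ.1 F))
  refine Subtype.ext (VectorMeasure.ext_of_generateFrom {F : Set T | IsClosed F}
    (fun F hF => closed F hF) ?_ isPiSystem_isClosed (closed _ isClosed_univ))
  rw [← borel_eq_generateFrom_isClosed]
  exact BorelSpace.measurable_eq

end Facts

variable (T 𝕜 n)

/-- The Monge-Kantorovich norm as a seminorm on the `𝕜`-vector space `cabv (K^n)`. -/
def mkSeminorm : Seminorm 𝕜 (Cabv T 𝕜 n) :=
  Seminorm.ofSMulLE mkNorm mkNorm_zero mkNorm_add_le mkNorm_smul_le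

/-- `cabv (K^n)` normed by the Monge-Kantorovich norm, with the metric `‖μ - ν‖_MK`. -/
@[reducible]
def mkNormedAddCommGroup : NormedAddCommGroup (Cabv T 𝕜 n) :=
  AddGroupNorm.toNormedAddCommGroup
    { (mkSeminorm T 𝕜 n).toAddGroupSeminorm with
      eq_zero_of_map_eq_zero' := fun _ h => eq_zero_of_mkNorm h }

variable {T 𝕜 n}

/-- The seminorm `p_f μ = |∫ f dμ|`. -/
def evalSeminorm (f : C(T, Vec 𝕜 n)) : Seminorm 𝕜 (Cabv T 𝕜 n) :=
  Seminorm.ofSMulLE (fun μ => ‖sesqInt f μ‖)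
    (by rw [sesqInt_zero, norm_zero])
    (fun μ ν => by rw [sesqInt_add]; exact norm_add_le _ _)
    (fun c μ => by rw [sesqInt_smul, norm_mul, RCLike.norm_conj])

variable (T 𝕜 n)

/-- The weak* topology on `cabv (K^n)`: the locally convex topology generated by the seminorms
`p_f`, `f ∈ C(K^n)`. -/
@[reducible]
def weakStarTopology : TopologicalSpace (Cabv T 𝕜 n) :=
  ⨅ f : C(T, Vec 𝕜 n),
    (evalSeminorm f).toSeminormedAddCommGroup.toUniformSpace.toTopologicalSpace

end MongeKantorovich

end

open MeasureTheory Filter Topology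
open scoped ENNReal NNReal

noncomputable section

namespace MongeKantorovich

set_option linter.unusedSectionVars false

variable {T : Type*} [MetricSpace T] [CompactSpace T] [MeasurableSpace T] [BorelSpace T]
  {𝕜 : Type*} [RCLike 𝕜] {n : ℕ}

/-! By Arzelà–Ascoli the test functions of the Monge-Kantorovich norm form a totally bounded set for
the sup norm, so on measures of bounded variation weak* convergence to zero forces convergence to
zero in norm (`tendsto_mkNorm_of_tendsto_sesqInt`).

Compactness avoids Riesz representation and Banach–Alaoglu. With `S` the closed unit ball of `K^n`,
a probability measure `P` on `T × S` is sent to `a` times its barycenter, the vector measure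
obtained by integrating the second coordinate over the fibres. The space of such `P` is compact, and
integrals of continuous functions depend continuously on `P`, so this map into `B_a` is norm
continuous and its range is closed. The range is also dense, since every element of `B_a` is
approximated by discrete measures (`exists_mkNorm_sub_barycenter_le`). Hence the map is onto and
`B_a` is compact. Being a quotient map, it also gives weak* continuity of the identity on `B_a`, and
the two topologies agree.

For infinite `T`, completeness would by Baire bound the variation on a Monge-Kantorovich ball.
Differences of Dirac masses at close distinct points contradict this. -/

/-! ### Elementary properties of the integral and the variation -/

theorem sesqInt_sub (f : C(T, Vec 𝕜 n)) (μ ν : Cabv T 𝕜 n) :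
    sesqInt f (μ - ν) = sesqInt f μ - sesqInt f ν := by
  refine (congrArg (sesqInt f) (sub_eq_add_neg μ ν)).trans ((sesqInt_add f μ (-ν)).trans ?_)
  rw [sesqInt_neg, sub_eq_add_neg]

theorem sesqInt_sub_left (f g : C(T, Vec 𝕜 n)) (μ : Cabv T 𝕜 n) :
    sesqInt (f - g) μ = sesqInt f μ - sesqInt g μ :=
  VectorMeasure.integral_sub (integrable_of_continuous f μ) (integrable_of_continuous g μ)

theorem varNorm_nonneg (μ : Cabv T 𝕜 n) : 0 ≤ varNorm μ := ENNReal.toReal_nonneg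

theorem norm_apply_le_varNorm (μ : Cabv T 𝕜 n) (A : Set T) : ‖μ.1 A‖ ≤ varNorm μ :=
  VectorMeasure.norm_measure_le_variation (measure_ne_top _ _) |>.trans (measureReal_mono (Set.subset_univ A))

theorem varNorm_sub_le (μ ν : Cabv T 𝕜 n) : varNorm (μ - ν) ≤ varNorm μ + varNorm ν := by
  rw [varNorm, varNorm, varNorm, ← ENNReal.toReal_add (measure_ne_top _ _) (measure_ne_top _ _)]
  exact ENNReal.toReal_mono (by finiteness)
    (VectorMeasure.variation_sub_le (μ := μ.1) (ν := ν.1) Set.univ)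

theorem varNorm_smul (c : 𝕜) (μ : Cabv T 𝕜 n) : varNorm (c • μ) = ‖c‖ * varNorm μ := by
  have h : (c • μ).1.variation Set.univ = ‖c‖₊ • μ.1.variation Set.univ := by
    change (c • μ.1).variation Set.univ = _
    rw [VectorMeasure.variation_smul]; rfl
  rw [varNorm, h, varNorm, ENNReal.smul_def, smul_eq_mul, ENNReal.toReal_mul]
  simp

theorem varNorm_le_of_forall_enorm_le {μ : Cabv T 𝕜 n} {m : Measure T} [IsFiniteMeasure m]
    (h : ∀ E, MeasurableSet E → ‖μ.1 E‖ₑ ≤ m E) : varNorm μ ≤ m.real Set.univ :=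
  ENNReal.toReal_mono (measure_ne_top _ _)
    (VectorMeasure.variation_le_of_forall_enorm_le h Set.univ)

/-! ### Lipschitz functions -/

theorem lipschitzWith_of_mem_unitBL {f : C(T, Vec 𝕜 n)} (hf : f ∈ unitBL T 𝕜 n) :
    LipschitzWith 1 f := by
  obtain ⟨⟨M, hM⟩, h1⟩ := hf
  refine LipschitzWith.of_dist_le_mul fun x y => ?_
  rcases eq_or_ne x y with rfl | hxy
  · simp
  have hb : BddAbove {r : ℝ | ∃ x y : T, x ≠ y ∧ r = ‖f x - f y‖ / dist x y} := by
    refine ⟨M, ?_⟩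
    rintro r ⟨x, y, hxy, rfl⟩
    rw [div_le_iff₀ (dist_pos.2 hxy), ← dist_eq_norm]
    exact hM.dist_le_mul x y
  have h2 : ‖f x - f y‖ / dist x y ≤ lipConst f := le_csSup hb ⟨x, y, hxy, rfl⟩
  rw [div_le_iff₀ (dist_pos.2 hxy), ← dist_eq_norm] at h2
  refine h2.trans (mul_le_mul_of_nonneg_right ?_ dist_nonneg)
  rw [NNReal.coe_one]
  linarith [norm_nonneg f]

theorem norm_le_one_of_mem_unitBL {f : C(T, Vec 𝕜 n)} (hf : f ∈ unitBL T 𝕜 n) : ‖f‖ ≤ 1 := by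
  linarith [hf.2, lipConst_nonneg f]

/-- Arzelà–Ascoli: the functions are 1-Lipschitz, with values in the compact unit ball of `K^n`. -/
theorem totallyBounded_unitBL : TotallyBounded (unitBL T 𝕜 n) := by
  let e := ContinuousMap.isometryEquivBoundedOfCompact T (Vec 𝕜 n)
  have key : IsCompact (closure (e '' unitBL T 𝕜 n)) := by
    refine BoundedContinuousFunction.arzela_ascoli (Metric.closedBall 0 1)
      (isCompact_closedBall 0 1) _ ?_ ?_
    · rintro _ x ⟨f, hf, rfl⟩
      rw [mem_closedBall_zero_iff]
      exact (f.norm_coe_le_norm x).trans (norm_le_one_of_mem_unitBL hf)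
    · refine UniformEquicontinuous.equicontinuous ?_
      refine LipschitzWith.uniformEquicontinuous _ 1 ?_
      rintro ⟨_, f, hf, rfl⟩
      exact lipschitzWith_of_mem_unitBL hf
  exact (totallyBounded_image_iff e.isometry.isUniformInducing).1
    (key.totallyBounded.subset subset_closure)

/-- On sets of bounded variation, weak* convergence implies convergence in the
Monge-Kantorovich norm. -/
theorem tendsto_mkNorm_of_tendsto_sesqInt {α : Type*} {l : Filter α} {u : α → Cabv T 𝕜 n}
    {C : ℝ} (hu : ∀ i, varNorm (u i) ≤ C)
    (h : ∀ f, Tendsto (fun i => sesqInt f (u i)) l (𝓝 0)) :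
    Tendsto (fun i => mkNorm (u i)) l (𝓝 0) := by
  rcases isEmpty_or_nonempty α with hα | ⟨⟨i₀⟩⟩
  · rw [Subsingleton.elim l ⊥]
    exact tendsto_bot
  have hC : 0 ≤ C := (varNorm_nonneg _).trans (hu i₀)
  rw [Metric.tendsto_nhds]
  intro ε hε
  -- At this mesh, replacing `f` by a net point changes the integral by at most `ε / 3`; `C + 1`
  -- avoids dividing by zero.
  have hδ : 0 < ε / 3 / (C + 1) := by positivity
  obtain ⟨t, ht, hcov⟩ := Metric.totallyBounded_iff.1 (totallyBounded_unitBL (T := T) (𝕜 := 𝕜)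
    (n := n)) _ hδ
  have hev : ∀ᶠ i in l, ∀ g ∈ t, ‖sesqInt g (u i)‖ < ε / 3 :=
    (eventually_all_finite ht).2 fun g _ => by
      simpa using (h g).norm.eventually_lt_const (u := ε / 3) (by simpa using by positivity)
  filter_upwards [hev] with i hi
  rw [Real.dist_0_eq_abs, abs_of_nonneg (mkNorm_nonneg _)]
  refine lt_of_le_of_lt (Real.sSup_le (a := ε / 3 + ε / 3) ?_ (by positivity)) (by linarith)
  rintro r ⟨f, hf, rfl⟩
  obtain ⟨g, hg, hfg⟩ := Set.mem_iUnion₂.1 (hcov hf)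
  rw [Metric.mem_ball, dist_eq_norm] at hfg
  have h1 : sesqInt f (u i) = sesqInt (f - g) (u i) + sesqInt g (u i) := by
    rw [sesqInt_sub_left]; ring
  rw [h1]
  refine (norm_add_le _ _).trans (add_le_add ?_ (hi g hg).le)
  refine (norm_sesqInt_le _ _).trans ?_
  calc ‖f - g‖ * varNorm (u i) ≤ ε / 3 / (C + 1) * (C + 1) :=
        mul_le_mul hfg.le ((hu i).trans (by linarith)) (varNorm_nonneg _) hδ.le
    _ = ε / 3 := by field_simp

/-! ### Barycenters of probability measures on `T × closedBall 0 1` -/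

theorem norm_snd_le_one (z : T × Metric.closedBall (0 : Vec 𝕜 n) 1) : ‖(z.2 : Vec 𝕜 n)‖ ≤ 1 :=
  mem_closedBall_zero_iff.1 z.2.2

theorem integrable_snd (P : ProbabilityMeasure (T × Metric.closedBall (0 : Vec 𝕜 n) 1)) :
    Integrable (fun z => (z.2 : Vec 𝕜 n)) P.toMeasure :=
  Integrable.of_bound (by fun_prop) 1 (Eventually.of_forall norm_snd_le_one)

/-- The vector measure `A ↦ ∫_{A × S} y dP(t, y)`, where `S` is the closed unit ball of `K^n`. -/
def barycenterAux (P : ProbabilityMeasure (T × Metric.closedBall (0 : Vec 𝕜 n) 1)) :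
    VectorMeasure T (Vec 𝕜 n) :=
  (P.toMeasure.withDensityᵥ fun z => (z.2 : Vec 𝕜 n)).map Prod.fst

theorem barycenterAux_apply (P : ProbabilityMeasure (T × Metric.closedBall (0 : Vec 𝕜 n) 1))
    {A : Set T} (hA : MeasurableSet A) :
    barycenterAux P A = ∫ z in Prod.fst ⁻¹' A, (z.2 : Vec 𝕜 n) ∂P.toMeasure := by
  rw [barycenterAux, VectorMeasure.map_apply _ measurable_fst hA,
    withDensityᵥ_apply (integrable_snd P) (measurable_fst hA)]

theorem enorm_barycenterAux_le (P : ProbabilityMeasure (T × Metric.closedBall (0 : Vec 𝕜 n) 1))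
    (A : Set T) (hA : MeasurableSet A) :
    ‖barycenterAux P A‖ₑ ≤ (P.toMeasure.map Prod.fst) A := by
  rw [barycenterAux_apply P hA, Measure.map_apply measurable_fst hA]
  refine (enorm_integral_le_lintegral_enorm _).trans ?_
  calc ∫⁻ z in Prod.fst ⁻¹' A, ‖(z.2 : Vec 𝕜 n)‖ₑ ∂P.toMeasure
      ≤ ∫⁻ z in Prod.fst ⁻¹' A, 1 ∂P.toMeasure := by
        refine lintegral_mono fun z => ?_
        rw [← ofReal_norm]
        exact ENNReal.ofReal_le_one.2 (norm_snd_le_one z)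
    _ = _ := by simp

/-- The measure `A ↦ ∫_{A × S} y dP(t, y)` of `cabv (K^n)`. -/
def barycenter (P : ProbabilityMeasure (T × Metric.closedBall (0 : Vec 𝕜 n) 1)) : Cabv T 𝕜 n :=
  ⟨barycenterAux P, (VectorMeasure.variation_le_of_forall_enorm_le (enorm_barycenterAux_le P)
    Set.univ).trans_lt (by
      rw [Measure.map_apply measurable_fst MeasurableSet.univ]
      exact measure_lt_top _ _)⟩

theorem varNorm_barycenter_le
    (P : ProbabilityMeasure (T × Metric.closedBall (0 : Vec 𝕜 n) 1)) :
    varNorm (barycenter P) ≤ 1 := by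
  have := Measure.isProbabilityMeasure_map (μ := P.toMeasure)
    (measurable_fst (α := T) (β := Metric.closedBall (0 : Vec 𝕜 n) 1)).aemeasurable
  simpa using varNorm_le_of_forall_enorm_le (μ := barycenter P) (enorm_barycenterAux_le P)

open Classical in
theorem integral_simpleFunc_barycenter
    (P : ProbabilityMeasure (T × Metric.closedBall (0 : Vec 𝕜 n) 1))
    (g : SimpleFunc T (Vec 𝕜 n)) :
    (barycenter P).1.integral g (pairing 𝕜 n) =
      ∫ z, inner 𝕜 (z.2 : Vec 𝕜 n) (g z.1) ∂P.toMeasure := by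
  induction g using SimpleFunc.induction with
  | @const x s hs =>
    rw [SimpleFunc.coe_piecewise, SimpleFunc.coe_const, SimpleFunc.coe_const,
      Function.const_zero, Set.piecewise_eq_indicator]
    refine (integral_indicator_const (barycenter P) hs x).trans ?_
    change inner 𝕜 (barycenterAux P s) x = _
    rw [barycenterAux_apply P hs, ← pairing_apply,
      ← (pairing 𝕜 n x).integral_comp_comm (integrable_snd P).integrableOn,
      ← integral_indicator (measurable_fst hs)]
    refine integral_congr_ae (Eventually.of_forall fun z => ?_)
    by_cases hz : z.1 ∈ s <;> simp [hz, pairing_apply]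
  | @add f g _ hf hg =>
    have hi : ∀ h : SimpleFunc T (Vec 𝕜 n), (barycenter P).1.Integrable h := fun h =>
      h.integrable_of_isFiniteMeasure
    have hj : ∀ h : SimpleFunc T (Vec 𝕜 n), Integrable
        (fun z => (inner 𝕜 (z.2 : Vec 𝕜 n) (h z.1) : 𝕜)) P.toMeasure := fun h => by
      obtain ⟨C, hC⟩ := h.exists_forall_norm_le
      have hm : Measurable fun z : T × Metric.closedBall (0 : Vec 𝕜 n) 1 => h z.1 :=
        h.measurable.comp measurable_fst
      refine Integrable.of_bound (C := 1 * C) ?_ (Eventually.of_forall fun z => ?_)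
      · exact (Measurable.inner (by fun_prop) hm).aestronglyMeasurable
      · exact (norm_inner_le_norm _ _).trans (mul_le_mul (norm_snd_le_one z) (hC _)
          (norm_nonneg _) zero_le_one)
    rw [SimpleFunc.coe_add, VectorMeasure.integral_add (hi _) (hi _), hf, hg,
      ← integral_add (hj f) (hj g)]
    simp only [Pi.add_apply, inner_add_right]

/-- Extends the simple function case by dominated convergence. The right side integrates a
continuous function against `P`, so weak convergence of `P` controls it. -/
theorem sesqInt_barycenter (f : C(T, Vec 𝕜 n))
    (P : ProbabilityMeasure (T × Metric.closedBall (0 : Vec 𝕜 n) 1)) :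
    sesqInt f (barycenter P) = ∫ z, inner 𝕜 (z.2 : Vec 𝕜 n) (f z.1) ∂P.toMeasure := by
  have hf : StronglyMeasurable f := f.continuous.stronglyMeasurable
  have h1 : Tendsto (fun k => (barycenter P).1.integral (hf.approxBounded ‖f‖ k) (pairing 𝕜 n))
      atTop (𝓝 (sesqInt f (barycenter P))) :=
    VectorMeasure.tendsto_integral_of_dominated_convergence (fun _ => ‖f‖)
      (fun k => (hf.approxBounded ‖f‖ k).stronglyMeasurable.aestronglyMeasurable)
      (integrable_const _)
      (fun k => Eventually.of_forall fun x => hf.norm_approxBounded_le (norm_nonneg _) k x)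
      (Eventually.of_forall fun x =>
        hf.tendsto_approxBounded_of_norm_le (f.norm_coe_le_norm x))
  simp_rw [integral_simpleFunc_barycenter] at h1
  refine tendsto_nhds_unique h1 ?_
  refine tendsto_integral_of_dominated_convergence (fun _ => 1 * ‖f‖) (fun k => ?_)
    (integrable_const _) (fun k => Eventually.of_forall fun z => ?_)
    (Eventually.of_forall fun z => ?_)
  · have hm : Measurable fun z : T × Metric.closedBall (0 : Vec 𝕜 n) 1 =>
        hf.approxBounded ‖f‖ k z.1 :=
      (hf.approxBounded ‖f‖ k).measurable.comp measurable_fst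
    exact (Measurable.inner (by fun_prop) hm).aestronglyMeasurable
  · exact (norm_inner_le_norm _ _).trans (mul_le_mul (norm_snd_le_one z)
      (hf.norm_approxBounded_le (norm_nonneg _) k z.1) (norm_nonneg _) zero_le_one)
  · exact tendsto_const_nhds.inner
      (hf.tendsto_approxBounded_of_norm_le (f.norm_coe_le_norm z.1))

theorem continuous_sesqInt_barycenter (f : C(T, Vec 𝕜 n)) :
    Continuous fun P : ProbabilityMeasure (T × Metric.closedBall (0 : Vec 𝕜 n) 1) =>
      sesqInt f (barycenter P) := by
  refine continuous_iff_continuousAt.2 fun P => ?_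
  simp_rw [ContinuousAt, sesqInt_barycenter]
  exact (ProbabilityMeasure.tendsto_iff_forall_integral_rclike_tendsto 𝕜).1 tendsto_id
    (BoundedContinuousFunction.mkOfCompact ⟨fun z : T × Metric.closedBall (0 : Vec 𝕜 n) 1 =>
      inner 𝕜 (z.2 : Vec 𝕜 n) (f z.1), by fun_prop⟩)

/-! ### Discretization -/

theorem exists_simpleFunc_dist_le [Nonempty T] {ε : ℝ} (hε : 0 < ε) :
    ∃ s : SimpleFunc T T, ∀ x, dist (s x) x ≤ ε := by
  obtain ⟨t, ht⟩ := isCompact_univ.elim_finite_subcover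
    (fun k : ℕ => Metric.ball (TopologicalSpace.denseSeq T k) ε) (fun _ => Metric.isOpen_ball)
    fun x _ => by
      obtain ⟨k, hk⟩ := (TopologicalSpace.denseRange_denseSeq T).exists_dist_lt x hε
      exact Set.mem_iUnion.2 ⟨k, hk⟩
  -- `t.sup id` is the largest index in the finite subcover, so all its centres compete for the
  -- nearest point.
  refine ⟨SimpleFunc.nearestPt (TopologicalSpace.denseSeq T) (t.sup id), fun x => ?_⟩
  obtain ⟨k, hk, hx⟩ := Set.mem_iUnion₂.1 (ht (Set.mem_univ x))
  have h := SimpleFunc.edist_nearestPt_le (TopologicalSpace.denseSeq T) x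
    (Finset.le_sup (f := id) hk)
  rw [edist_dist, edist_dist, ENNReal.ofReal_le_ofReal_iff dist_nonneg] at h
  exact h.trans (by rw [dist_comm]; exact (Metric.mem_ball.1 hx).le)

/-- The sum is the integral of `f ∘ s`, which is uniformly within `ε` of `f`. -/
theorem norm_sesqInt_sub_sum_le {f : C(T, Vec 𝕜 n)} (hf : LipschitzWith 1 f)
    {s : SimpleFunc T T} {ε : ℝ} (hs : ∀ x, dist (s x) x ≤ ε) (μ : Cabv T 𝕜 n) :
    ‖sesqInt f μ - ∑ t ∈ s.range, inner 𝕜 (μ.1 (s ⁻¹' {t})) (f t)‖ ≤ ε * varNorm μ := by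
  classical
  have hi : ∀ t ∈ s.range, μ.1.Integrable ((s ⁻¹' {t}).indicator fun _ => f t) := fun t _ =>
    (integrable_const _).indicator (s.measurableSet_fiber t)
  have hsum : (fun x : T => ∑ t ∈ s.range, (s ⁻¹' {t}).indicator (fun _ => f t) x) =
      fun x => f (s x) := by
    ext1 x
    rw [Finset.sum_eq_single (s x)]
    · simp
    · intro t _ ht
      refine Set.indicator_of_notMem ?_ _
      exact fun h => ht h.symm
    · exact fun h => absurd (s.mem_range_self x) h
  have h1 : μ.1.integral (fun x => f (s x)) (pairing 𝕜 n) =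
      ∑ t ∈ s.range, inner 𝕜 (μ.1 (s ⁻¹' {t})) (f t) := by
    rw [← hsum, VectorMeasure.integral_finsetSum _ hi]
    exact Finset.sum_congr rfl fun t _ =>
      integral_indicator_const μ (s.measurableSet_fiber t) (f t)
  have h2 : μ.1.Integrable fun x => f (s x) := by
    rw [← hsum]
    exact integrable_finsetSum _ hi
  rw [← h1, sesqInt, ← VectorMeasure.integral_sub (integrable_of_continuous f μ) h2]
  refine (VectorMeasure.norm_integral_le_of_norm_le_const (C := ε)
    (Eventually.of_forall fun x => ?_)).trans ?_
  · rw [Pi.sub_apply, ← dist_eq_norm, dist_comm]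
    exact (hf.dist_le_mul _ _).trans (by simpa using hs x)
  -- `0 ≤ ε` follows from `hs` only if `T` has a point.
  · rcases isEmpty_or_nonempty T with hT | ⟨⟨x⟩⟩
    · simp [varNorm, Set.eq_empty_of_isEmpty, measureReal_def]
    · exact mul_le_mul_of_nonneg_right (mul_le_of_le_one_right
        (dist_nonneg.trans (hs x)) norm_pairing_le) ENNReal.toReal_nonneg

theorem sum_norm_fiber_le (s : SimpleFunc T T) (μ : Cabv T 𝕜 n) :
    ∑ t ∈ s.range, ‖μ.1 (s ⁻¹' {t})‖ ≤ varNorm μ := by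
  calc ∑ t ∈ s.range, ‖μ.1 (s ⁻¹' {t})‖
      ≤ ∑ t ∈ s.range, μ.1.variation.real (s ⁻¹' {t}) :=
        Finset.sum_le_sum fun t _ => VectorMeasure.norm_measure_le_variation (measure_ne_top _ _)
    _ = μ.1.variation.real (⋃ t ∈ s.range, s ⁻¹' {t}) :=
        (measureReal_biUnion_finset (fun t _ t' _ h => Set.disjoint_left.2 fun x hx hx' =>
          h (hx.symm.trans hx')) fun t _ => s.measurableSet_fiber t).symm
    _ ≤ varNorm μ := measureReal_mono (Set.subset_univ _)

/-- Put mass `‖m t‖ / a` at `t` paired with the direction of `m t`. The leftover mass sits over the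
zero vector, where it contributes nothing. -/
theorem exists_sesqInt_barycenter_eq_sum [Nonempty T] {a : ℝ} (ha : 0 < a) (S : Finset T)
    (m : T → Vec 𝕜 n) (hm : ∑ t ∈ S, ‖m t‖ ≤ a) :
    ∃ P : ProbabilityMeasure (T × Metric.closedBall (0 : Vec 𝕜 n) 1),
      ∀ f : C(T, Vec 𝕜 n),
        sesqInt f ((a : 𝕜) • barycenter P) = ∑ t ∈ S, inner 𝕜 (m t) (f t) := by
  obtain ⟨t₀⟩ := ‹Nonempty T›
  let v : T → Metric.closedBall (0 : Vec 𝕜 n) 1 := fun t =>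
    -- If `m t = 0`, the convention `0⁻¹ = 0` gives the zero vector.
    ⟨((‖m t‖⁻¹ : ℝ) : 𝕜) • m t, by
      rw [mem_closedBall_zero_iff, norm_smul, RCLike.norm_ofReal, abs_inv, abs_norm]
      exact inv_mul_le_one⟩
  let v₀ : Metric.closedBall (0 : Vec 𝕜 n) 1 := ⟨0, by simp⟩
  let c : T → ℝ := fun t => ‖m t‖ / a
  have hc : ∀ t, 0 ≤ c t := fun t => by positivity
  have hc1 : ∑ t ∈ S, c t ≤ 1 := by
    rw [← Finset.sum_div]
    exact (div_le_one ha).2 hm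
  let Q : Measure (T × Metric.closedBall (0 : Vec 𝕜 n) 1) :=
    (∑ t ∈ S, ENNReal.ofReal (c t) • Measure.dirac (t, v t)) +
      ENNReal.ofReal (1 - ∑ t ∈ S, c t) • Measure.dirac (t₀, v₀)
  have hQ : IsProbabilityMeasure Q := by
    constructor
    simp only [Q, Measure.add_apply, Measure.finsetSum_apply, Measure.smul_apply, measure_univ,
      smul_eq_mul, mul_one]
    rw [← ENNReal.ofReal_sum_of_nonneg fun t _ => hc t, ← ENNReal.ofReal_add
      (Finset.sum_nonneg fun t _ => hc t) (by linarith)]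
    simp
  let P : ProbabilityMeasure (T × Metric.closedBall (0 : Vec 𝕜 n) 1) := ⟨Q, hQ⟩
  refine ⟨P, fun f => ?_⟩
  let g : C(T × Metric.closedBall (0 : Vec 𝕜 n) 1, 𝕜) :=
    ⟨fun z => inner 𝕜 (z.2 : Vec 𝕜 n) (f z.1), by fun_prop⟩
  have hg : ∀ ν : Measure (T × Metric.closedBall (0 : Vec 𝕜 n) 1), IsFiniteMeasure ν →
      Integrable g ν := fun ν _ =>
    Integrable.of_bound g.continuous.aestronglyMeasurable ‖g‖
      (Eventually.of_forall g.norm_coe_le_norm)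
  rw [sesqInt_smul, sesqInt_barycenter, RCLike.conj_ofReal]
  change (a : 𝕜) * ∫ z, g z ∂Q = _
  have hfin : ∀ (r : ℝ) z, IsFiniteMeasure (ENNReal.ofReal r •
      (Measure.dirac z : Measure (T × Metric.closedBall (0 : Vec 𝕜 n) 1))) := fun r z =>
    Measure.smul_finite _ ENNReal.ofReal_ne_top
  rw [integral_add_measure (hg _ inferInstance) (hg _ (hfin _ _)),
    integral_finsetSum_measure fun t _ => hg _ (hfin _ _)]
  simp only [integral_smul_measure, integral_dirac]
  have h0 : g (t₀, v₀) = 0 := inner_zero_left (𝕜 := 𝕜) (f t₀)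
  rw [h0, smul_zero, add_zero, Finset.mul_sum]
  refine Finset.sum_congr rfl fun t _ => ?_
  have h1 : g (t, v t) = ((‖m t‖⁻¹ : ℝ) : 𝕜) * inner 𝕜 (m t) (f t) := by
    change inner 𝕜 (((‖m t‖⁻¹ : ℝ) : 𝕜) • m t) (f t) = _
    rw [inner_smul_left, RCLike.conj_ofReal]
  rw [h1, ENNReal.toReal_ofReal (hc t), RCLike.real_smul_eq_coe_mul, ← mul_assoc, ← mul_assoc,
    ← RCLike.ofReal_mul, ← RCLike.ofReal_mul]
  rcases eq_or_ne (m t) 0 with h | h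
  · simp [h]
  · have h2 : a * c t * ‖m t‖⁻¹ = 1 := by
      have := norm_ne_zero_iff.2 h
      simp only [c]
      field_simp
    rw [h2, RCLike.ofReal_one, one_mul]

theorem exists_mkNorm_sub_barycenter_le [Nonempty T] {a : ℝ} (ha : 0 < a) {μ : Cabv T 𝕜 n}
    (hμ : μ ∈ varBall T 𝕜 n a) {ε : ℝ} (hε : 0 < ε) :
    ∃ P : ProbabilityMeasure (T × Metric.closedBall (0 : Vec 𝕜 n) 1),
      mkNorm (μ - (a : 𝕜) • barycenter P) ≤ ε := by
  obtain ⟨s, hs⟩ := exists_simpleFunc_dist_le (T := T) (div_pos hε ha)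
  obtain ⟨P, hP⟩ := exists_sesqInt_barycenter_eq_sum ha s.range (fun t => μ.1 (s ⁻¹' {t}))
    ((sum_norm_fiber_le s μ).trans hμ)
  refine ⟨P, Real.sSup_le ?_ hε.le⟩
  rintro r ⟨f, hf, rfl⟩
  rw [sesqInt_sub, hP]
  refine (norm_sesqInt_sub_sum_le (lipschitzWith_of_mem_unitBL hf) hs μ).trans ?_
  calc ε / a * varNorm μ ≤ ε / a * a := by gcongr; exact hμ
    _ = ε := by field_simp

/-! ### Compactness of the ball and comparison of the two topologies -/

theorem smul_barycenter_mem_varBall {a : ℝ} (ha : 0 < a)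
    (P : ProbabilityMeasure (T × Metric.closedBall (0 : Vec 𝕜 n) 1)) :
    (a : 𝕜) • barycenter P ∈ varBall T 𝕜 n a := by
  change varNorm _ ≤ a
  rw [varNorm_smul, RCLike.norm_ofReal, abs_of_pos ha]
  exact mul_le_of_le_one_right ha.le (varNorm_barycenter_le P)

variable (𝕜 n) in
/-- The parametrization of `B_a(K^n)` by the probability measures on `T × closedBall 0 1`. -/
def ballMap {a : ℝ} (ha : 0 < a)
    (P : ProbabilityMeasure (T × Metric.closedBall (0 : Vec 𝕜 n) 1)) : varBall T 𝕜 n a :=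
  ⟨(a : 𝕜) • barycenter P, smul_barycenter_mem_varBall ha P⟩

theorem continuous_sesqInt_ballMap {a : ℝ} (ha : 0 < a) (f : C(T, Vec 𝕜 n)) :
    Continuous fun P => sesqInt f (ballMap 𝕜 n ha P).1 := by
  simp only [ballMap, sesqInt_smul]
  exact (continuous_sesqInt_barycenter f).const_mul _

/-- Each seminorm `p_f` defines the pseudometric pulled back from `𝕜` by `sesqInt f`. -/
theorem continuous_weakStarTopology_iff {α : Type*} [TopologicalSpace α] {u : α → Cabv T 𝕜 n} :
    Continuous[_, weakStarTopology T 𝕜 n] u ↔ ∀ f, Continuous fun i => sesqInt f (u i) := by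
  rw [weakStarTopology, continuous_iInf_rng]
  refine forall_congr' fun f => ?_
  let : SeminormedAddCommGroup (Cabv T 𝕜 n) := (evalSeminorm f).toSeminormedAddCommGroup
  have hd : ∀ μ ν : Cabv T 𝕜 n, dist μ ν = dist (sesqInt f μ) (sesqInt f ν) := fun μ ν => by
    rw [dist_eq_norm, dist_eq_norm, ← sesqInt_sub]; rfl
  change Continuous u ↔ _
  rw [continuous_iff_continuousAt, continuous_iff_continuousAt]
  refine forall_congr' fun i => ?_
  rw [ContinuousAt, ContinuousAt, tendsto_iff_dist_tendsto_zero,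
    tendsto_iff_dist_tendsto_zero (f := fun i => sesqInt f (u i))]
  simp only [hd]

section MongeKantorovichTopology

attribute [local instance] mkNormedAddCommGroup

theorem continuous_of_continuous_sesqInt {α : Type*} [TopologicalSpace α] {a : ℝ}
    {u : α → varBall T 𝕜 n a} (h : ∀ f, Continuous fun i => sesqInt f (u i).1) :
    Continuous u := by
  refine continuous_induced_rng.2 (continuous_iff_continuousAt.2 fun i => ?_)
  rw [ContinuousAt, tendsto_iff_norm_sub_tendsto_zero]
  -- Differences of two elements of the ball have variation at most `a + a`.
  refine tendsto_mkNorm_of_tendsto_sesqInt (C := a + a)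
    (fun j => (varNorm_sub_le _ _).trans (add_le_add (u j).2 (u i).2)) fun f => ?_
  simp only [Function.comp_apply, sesqInt_sub]
  simpa using ((h f).tendsto i).sub_const (sesqInt f (u i).1)

theorem continuous_ballMap {a : ℝ} (ha : 0 < a) :
    Continuous (ballMap 𝕜 n ha (T := T)) :=
  continuous_of_continuous_sesqInt (continuous_sesqInt_ballMap ha)

/-- The range is compact, hence closed, and it is dense by discretization. -/
theorem surjective_ballMap [Nonempty T] {a : ℝ} (ha : 0 < a) :
    Function.Surjective (ballMap 𝕜 n ha (T := T)) := by
  have hcl : IsClosed (Set.range (ballMap 𝕜 n ha (T := T))) :=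
    (isCompact_range (continuous_ballMap ha)).isClosed
  intro μ
  change μ ∈ Set.range _
  rw [← hcl.closure_eq, Metric.mem_closure_range_iff]
  intro ε hε
  obtain ⟨P, hP⟩ := exists_mkNorm_sub_barycenter_le ha μ.2 (half_pos hε)
  refine ⟨P, ?_⟩
  rw [Subtype.dist_eq, dist_eq_norm]
  exact lt_of_le_of_lt hP (half_lt_self hε)

instance subsingletonCabv [IsEmpty T] : Subsingleton (Cabv T 𝕜 n) :=
  ⟨fun μ ν => Subtype.ext (VectorMeasure.ext fun s _ => by
    rw [Set.eq_empty_of_isEmpty s, VectorMeasure.empty, VectorMeasure.empty])⟩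

theorem compactSpace_varBall {a : ℝ} (ha : 0 < a) : CompactSpace (varBall T 𝕜 n a) := by
  rcases isEmpty_or_nonempty T with hT | hT
  · infer_instance
  · rw [← isCompact_univ_iff, ← (surjective_ballMap ha).range_eq]
    exact isCompact_range (continuous_ballMap ha)

theorem topology_varBall_eq {a : ℝ} (ha : 0 < a) :
    (UniformSpace.toTopologicalSpace : TopologicalSpace (varBall T 𝕜 n a)) =
      TopologicalSpace.induced Subtype.val (weakStarTopology T 𝕜 n) := by
  rcases isEmpty_or_nonempty T with hT | hT
  · exact Subsingleton.elim _ _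
  refine le_antisymm ?_ ?_
  · rw [← continuous_iff_le_induced, continuous_weakStarTopology_iff]
    -- The norm directly controls only Lipschitz integrands. For a general continuous `f`,
    -- continuity is checked after composing with `ballMap`, a quotient map from a compact space
    -- onto a Hausdorff one.
    exact fun f => (((continuous_ballMap ha).isClosedMap.isQuotientMap (continuous_ballMap ha)
      (surjective_ballMap ha)).continuous_iff).2 (continuous_sesqInt_ballMap ha f)
  · let τ : TopologicalSpace (varBall T 𝕜 n a) :=
      TopologicalSpace.induced Subtype.val (weakStarTopology T 𝕜 n)
    exact continuous_id_iff_le.1 (continuous_of_continuous_sesqInt (α := varBall T 𝕜 n a)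
      (u := id) (continuous_weakStarTopology_iff.1 continuous_induced_dom))

/-! ### Incompleteness -/

/-- Baire category: the variation balls of integer radius are compact, hence closed, and cover the
space, so one has an interior point. Translating it to the origin doubles the bound. -/
theorem exists_varNorm_le_of_completeSpace [CompleteSpace (Cabv T 𝕜 n)] :
    ∃ r > 0, ∃ C, ∀ μ : Cabv T 𝕜 n, mkNorm μ < r → varNorm μ ≤ C := by
  have hcl : ∀ k : ℕ, IsClosed (varBall T 𝕜 n ((k : ℝ) + 1)) := fun k =>
    (isCompact_iff_compactSpace.2 (compactSpace_varBall (by positivity))).isClosed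
  have hU : ⋃ k : ℕ, varBall T 𝕜 n ((k : ℝ) + 1) = Set.univ := by
    refine Set.eq_univ_of_forall fun μ => Set.mem_iUnion.2 ?_
    obtain ⟨k, hk⟩ := exists_nat_ge (varNorm μ)
    exact ⟨k, hk.trans (by linarith)⟩
  obtain ⟨k, μ₀, h₀⟩ := nonempty_interior_of_iUnion_of_closed hcl hU
  obtain ⟨r, hr, hball⟩ := Metric.isOpen_iff.1 isOpen_interior μ₀ h₀
  refine ⟨r, hr, (k + 1) + (k + 1), fun μ hμ => ?_⟩
  have h1 : μ₀ + μ ∈ varBall T 𝕜 n ((k : ℝ) + 1) := by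
    refine interior_subset (hball ?_)
    rwa [Metric.mem_ball, dist_self_add_left]
  have h2 := varNorm_sub_le (μ₀ + μ) μ₀
  rw [add_sub_cancel_left] at h2
  have h3 : μ₀ ∈ varBall T 𝕜 n ((k : ℝ) + 1) := interior_subset h₀
  exact h2.trans (add_le_add h1 h3)

/-- Otherwise `T` would be discrete and compact, hence finite. -/
theorem exists_ne_dist_lt [Infinite T] {ε : ℝ} (hε : 0 < ε) :
    ∃ x y : T, x ≠ y ∧ dist x y < ε := by
  by_contra! h
  have := DiscreteTopology.of_forall_le_dist hε fun x y hxy => h x y hxy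
  exact not_finite_iff_infinite.2 ‹Infinite T› (finite_of_compact_of_discrete)

/-- The measure `A ↦ 1_A(x) v`. -/
def diracMeasure (x : T) (v : Vec 𝕜 n) : Cabv T 𝕜 n :=
  ⟨VectorMeasure.dirac x v, by
    change (VectorMeasure.dirac x v).variation Set.univ < ∞
    simp⟩

theorem sesqInt_diracMeasure (f : C(T, Vec 𝕜 n)) (x : T) (v : Vec 𝕜 n) :
    sesqInt f (diracMeasure x v) = inner 𝕜 v (f x) :=
  VectorMeasure.integral_dirac

theorem mkNorm_diracMeasure_sub_le (x y : T) (v : Vec 𝕜 n) :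
    mkNorm (diracMeasure x v - diracMeasure y v) ≤ ‖v‖ * dist x y := by
  refine Real.sSup_le ?_ (by positivity)
  rintro r ⟨f, hf, rfl⟩
  rw [sesqInt_sub, sesqInt_diracMeasure, sesqInt_diracMeasure, ← inner_sub_right]
  refine (norm_inner_le_norm _ _).trans (mul_le_mul_of_nonneg_left ?_ (norm_nonneg v))
  simpa [dist_eq_norm] using (lipschitzWith_of_mem_unitBL hf).dist_le_mul x y

theorem norm_le_varNorm_diracMeasure_sub {x y : T} (hxy : x ≠ y) (v : Vec 𝕜 n) :
    ‖v‖ ≤ varNorm (diracMeasure x v - diracMeasure y v) := by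
  refine le_of_eq_of_le ?_ (norm_apply_le_varNorm _ {x})
  change _ = ‖VectorMeasure.dirac x v {x} - VectorMeasure.dirac y v {x}‖
  simp [hxy.symm]

theorem not_completeSpace [Infinite T] (hn : 1 ≤ n) : ¬ CompleteSpace (Cabv T 𝕜 n) := by
  intro _
  obtain ⟨r, hr, C, h⟩ := exists_varNorm_le_of_completeSpace (T := T) (𝕜 := 𝕜) (n := n)
  -- The norm of `v` exceeds `C` and bounds the variation of the Dirac difference from below.
  -- Choosing the points within `r / ‖v‖` keeps its Monge-Kantorovich norm below `r`.
  let v : Vec 𝕜 n := EuclideanSpace.single ⟨0, hn⟩ ((|C| + 1 : ℝ) : 𝕜)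
  have hv : ‖v‖ = |C| + 1 := by
    rw [PiLp.norm_single, RCLike.norm_ofReal, abs_of_pos (by positivity)]
  have hv0 : 0 < ‖v‖ := by rw [hv]; positivity
  obtain ⟨x, y, hxy, hd⟩ := exists_ne_dist_lt (T := T) (div_pos hr hv0)
  rw [lt_div_iff₀' hv0] at hd
  have h1 := h _ ((mkNorm_diracMeasure_sub_le x y v).trans_lt hd)
  have h2 := (norm_le_varNorm_diracMeasure_sub hxy v).trans h1
  linarith [le_abs_self C]

end MongeKantorovichTopology

end MongeKantorovich

end

theorem theorem13 {T : Type*} [MetricSpace T] [CompactSpace T] [MeasurableSpace T] [BorelSpace T]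
    {𝕜 : Type*} [RCLike 𝕜] (n : ℕ) (hn : 1 ≤ n) :
    letI : NormedAddCommGroup (MongeKantorovich.Cabv T 𝕜 n) :=
      MongeKantorovich.mkNormedAddCommGroup T 𝕜 n
    (∀ a : ℝ, 0 < a →
      CompactSpace (MongeKantorovich.varBall T 𝕜 n a) ∧
      CompleteSpace (MongeKantorovich.varBall T 𝕜 n a) ∧
      (UniformSpace.toTopologicalSpace :
          TopologicalSpace (MongeKantorovich.varBall T 𝕜 n a)) =
        TopologicalSpace.induced Subtype.val (MongeKantorovich.weakStarTopology T 𝕜 n)) ∧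
    (Infinite T → ¬ CompleteSpace (MongeKantorovich.Cabv T 𝕜 n)) := by
  refine ⟨fun a ha => ?_, fun _ => MongeKantorovich.not_completeSpace hn⟩
  let : NormedAddCommGroup (MongeKantorovich.Cabv T 𝕜 n) :=
    MongeKantorovich.mkNormedAddCommGroup T 𝕜 n
  have hK := MongeKantorovich.compactSpace_varBall (T := T) (𝕜 := 𝕜) (n := n) ha
  exact ⟨hK, inferInstance, MongeKantorovich.topology_varBall_eq ha⟩
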